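/- Let $(X,\mathcal B,\mu)$ be a $\sigma$-finite measure space, let $1\le p<\infty$, and let $f:X\to X$ be a bijection such that $f$ and $f^{-1}$ are measurable. Assume that there is $c>0$ with $\mu(f^{-1}(B))\le c\,\mu(B)$ and $\mu(f(B))\le c\,\mu(B)$ for every $B\in\mathcal B$, so that the composition operator $T_f:L^p(X)\to L^p(X)$, $T_f\varphi=\varphi\circ f$ (real or complex scalars), is a well-defined bounded invertible operator with inverse $T_{f^{-1}}$. Assume that $(X,\mathcal B,\mu,f)$ is a dissipative system of bounded distortion generated by $W\in\mathcal B$, that is: $0<\mu(W)<\infty$; $X$ is the union of the pairwise disjoint sets $f^k(W)$, $k\in\mathbb Z$; and there is $K>0$ such that $$\frac1K\,\mu(f^k(W))\,\mu(B)\le\mu(f^k(B))\,\mu(W)\le K\,\mu(f^k(W))\,\mu(B)$$ for all $k\in\mathbb Z$ and all $B\in\mathcal B$ with $B\subseteq W$. An invertible bounded operator $T$ on a Banach space $E$ has the shadowing property if for every $\varepsilon>0$ there is $\delta>0$ such that for every sequence $(x_n)_{n\in\mathbb Z}$ in $E$ with $\|Tx_n-x_{n+1}\|\le\delta$ for all $n\in\mathbb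 Z$ there is $x\in E$ with $\|T^nx-x_n\|<\varepsilon$ for all $n\in\mathbb Z$. Then $T_f$ has the shadowing property if and only if one of the following three conditions holds: 1. $\displaystyle\limsup_{n\to\infty}\ \sup_{k\in\mathbb Z}\left(\frac{\mu(f^k(W))}{\mu(f^{k+n}(W))}\right)^{1/n}<1$; 2. $\displaystyle\liminf_{n\to\infty}\ \inf_{k\in\mathbb Z}\left(\frac{\mu(f^k(W))}{\mu(f^{k+n}(W))}\right)^{1/n}>1$; 3. $\displaystyle\limsup_{n\to\infty}\ \sup_{k\le 0}\left(\frac{\mu(f^{k-n}(W))}{\mu(f^{k}(W))}\right)^{1/n}<1$ and $\displaystyle\liminf_{n\to\infty}\ \inf_{k\ge 0}\left(\frac{\mu(f^k(W))}{\mu(f^{k+n}(W))}\right)^{1/n}>1$ (with $k$ ranging over the integers). -/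

import Mathlib

open MeasureTheory Filter
open scoped ENNReal NNReal

noncomputable section

namespace CompositionDynamics

/-! ### Shadowing for invertible operators -/

section Shadowing

variable {𝕜 E : Type*} [NontriviallyNormedField 𝕜] [NormedAddCommGroup E] [NormedSpace 𝕜 E]

/-- A bi-infinite sequence `x` is a `δ`-pseudotrajectory of `T` if `‖T xₙ - xₙ₊₁‖ ≤ δ` for all
integers `n`. -/
def IsPseudotrajectory (T : E ≃L[𝕜] E) (δ : ℝ) (x : ℤ → E) : Prop :=
  ∀ n : ℤ, ‖T (x n) - x (n + 1)‖ ≤ δ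

/-- The shadowing property of an invertible operator `T`. Here `T ^ n` is the `n`-th power, `n ∈ ℤ`,
in the group of bounded invertible operators. -/
def HasShadowingProperty (T : E ≃L[𝕜] E) : Prop :=
  ∀ ε : ℝ, 0 < ε → ∃ δ : ℝ, 0 < δ ∧
    ∀ x : ℤ → E, IsPseudotrajectory T δ x → ∃ y : E, ∀ n : ℤ, ‖(T ^ n) y - x n‖ < ε

end Shadowing

/-! ### Composition operators on `L^p` -/

variable {X : Type*} [MeasurableSpace X]

/-- There is `c > 0` with `μ (f⁻¹ B) ≤ c μ(B)` for every measurable `B`. -/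
def CompositionBound (f : X ≃ᵐ X) (μ : Measure X) : Prop :=
  ∃ c : ℝ≥0, 0 < c ∧ ∀ B : Set X, MeasurableSet B → μ (f ⁻¹' B) ≤ c * μ B

theorem CompositionBound.exists_map_le {f : X ≃ᵐ X} {μ : Measure X} (hf : CompositionBound f μ) :
    ∃ c : ℝ≥0, 0 < c ∧ μ.map f ≤ (c : ℝ≥0∞) • μ := by
  obtain ⟨c, hc, h⟩ := hf
  refine ⟨c, hc, Measure.le_iff.2 fun B hB => ?_⟩
  rw [Measure.map_apply f.measurable hB]
  simpa using h B hB

theorem CompositionBound.quasiMeasurePreserving {f : X ≃ᵐ X} {μ : Measure X}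
    (hf : CompositionBound f μ) : Measure.QuasiMeasurePreserving f μ μ := by
  obtain ⟨c, -, h⟩ := hf.exists_map_le
  exact ⟨f.measurable, (Measure.absolutelyContinuous_of_le h).trans
    Measure.smul_absolutelyContinuous⟩

theorem CompositionBound.exists_eLpNorm_le {f : X ≃ᵐ X} {μ : Measure X}
    (hf : CompositionBound f μ) (𝕜 : Type*) [RCLike 𝕜] (p : ℝ≥0∞) :
    ∃ C : ℝ≥0, ∀ φ : X → 𝕜, AEStronglyMeasurable φ μ →
      eLpNorm (φ ∘ f) p μ ≤ C * eLpNorm φ p μ := by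
  obtain ⟨c, hc, h⟩ := hf.exists_map_le
  refine ⟨c ^ (1 / p).toReal, fun φ hφ => ?_⟩
  have h0 : (c : ℝ≥0∞) ≠ 0 := by exact_mod_cast hc.ne'
  have hφ' : AEStronglyMeasurable φ (μ.map f) :=
    hφ.mono_ac hf.quasiMeasurePreserving.absolutelyContinuous
  rw [← eLpNorm_map_measure hφ' f.measurable.aemeasurable]
  refine (eLpNorm_mono_measure φ h).trans ?_
  rw [eLpNorm_smul_measure_of_ne_zero h0, smul_eq_mul,
    ENNReal.coe_rpow_of_nonneg _ ENNReal.toReal_nonneg]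

theorem CompositionBound.memLp_comp {f : X ≃ᵐ X} {μ : Measure X} (hf : CompositionBound f μ)
    {𝕜 : Type*} [RCLike 𝕜] {p : ℝ≥0∞} {φ : X → 𝕜} (hφ : MemLp φ p μ) : MemLp (φ ∘ f) p μ := by
  obtain ⟨C, hC⟩ := hf.exists_eLpNorm_le 𝕜 p
  exact ⟨hφ.1.comp_quasiMeasurePreserving hf.quasiMeasurePreserving,
    (hC φ hφ.1).trans_lt (ENNReal.mul_lt_top ENNReal.coe_lt_top hφ.2)⟩

/-- The bounded operator `φ ↦ φ ∘ f` on `L^p(μ)`. -/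
def compositionMap (𝕜 : Type*) [RCLike 𝕜] (p : ℝ≥0∞) [Fact (1 ≤ p)] {f : X ≃ᵐ X}
    {μ : Measure X} (hf : CompositionBound f μ) : Lp 𝕜 p μ →L[𝕜] Lp 𝕜 p μ :=
  LinearMap.mkContinuousOfExistsBound
    { toFun := fun φ => (hf.memLp_comp (Lp.memLp φ)).toLp (φ ∘ f)
      map_add' := fun φ ψ => by
        rw [← MemLp.toLp_add, MemLp.toLp_eq_toLp_iff]
        exact hf.quasiMeasurePreserving.ae_eq_comp (Lp.coeFn_add φ ψ)
      map_smul' := fun a φ => by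
        rw [RingHom.id_apply, ← MemLp.toLp_const_smul, MemLp.toLp_eq_toLp_iff]
        exact hf.quasiMeasurePreserving.ae_eq_comp (Lp.coeFn_smul a φ) }
    (by
      obtain ⟨C, hC⟩ := hf.exists_eLpNorm_le 𝕜 p
      refine ⟨C, fun φ => ?_⟩
      have h := hC φ (Lp.aestronglyMeasurable φ)
      change ‖(hf.memLp_comp (Lp.memLp φ)).toLp (φ ∘ f)‖ ≤ C * ‖φ‖
      rw [Lp.norm_toLp, Lp.norm_def]
      have := ENNReal.toReal_mono
        (ENNReal.mul_ne_top ENNReal.coe_ne_top (Lp.eLpNorm_ne_top φ)) h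
      simpa using this)

theorem coeFn_compositionMap (𝕜 : Type*) [RCLike 𝕜] (p : ℝ≥0∞) [Fact (1 ≤ p)] {f : X ≃ᵐ X}
    {μ : Measure X} (hf : CompositionBound f μ) (φ : Lp 𝕜 p μ) :
    compositionMap 𝕜 p hf φ =ᵐ[μ] φ ∘ f :=
  MemLp.coeFn_toLp (hf.memLp_comp (Lp.memLp φ))

/-- The invertible composition operator `T_f : φ ↦ φ ∘ f` on `L^p(μ)`, with inverse
`T_{f⁻¹} : φ ↦ φ ∘ f⁻¹`. -/
def compositionOperator (𝕜 : Type*) [RCLike 𝕜] (p : ℝ≥0∞) [Fact (1 ≤ p)] {f : X ≃ᵐ X}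
    {μ : Measure X} (hf : CompositionBound f μ) (hf' : CompositionBound f.symm μ) :
    Lp 𝕜 p μ ≃L[𝕜] Lp 𝕜 p μ :=
  ContinuousLinearEquiv.equivOfInverse (compositionMap 𝕜 p hf) (compositionMap 𝕜 p hf')
    (fun φ => by
      apply Lp.ext
      filter_upwards [coeFn_compositionMap 𝕜 p hf' (compositionMap 𝕜 p hf φ),
        hf'.quasiMeasurePreserving.ae_eq_comp (coeFn_compositionMap 𝕜 p hf φ)] with x h1 h2
      rw [h1, h2]
      simp)
    (fun φ => by
      apply Lp.ext
      filter_upwards [coeFn_compositionMap 𝕜 p hf (compositionMap 𝕜 p hf' φ),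
        hf.quasiMeasurePreserving.ae_eq_comp (coeFn_compositionMap 𝕜 p hf' φ)] with x h1 h2
      rw [h1, h2]
      simp)

theorem coeFn_compositionOperator (𝕜 : Type*) [RCLike 𝕜] (p : ℝ≥0∞) [Fact (1 ≤ p)] {f : X ≃ᵐ X}
    {μ : Measure X} (hf : CompositionBound f μ) (hf' : CompositionBound f.symm μ)
    (φ : Lp 𝕜 p μ) : compositionOperator 𝕜 p hf hf' φ =ᵐ[μ] φ ∘ f :=
  coeFn_compositionMap 𝕜 p hf φ

/-! ### Dissipative systems of bounded distortion -/

/-- The image `f^k(B)`, for `k ∈ ℤ`. -/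
def iterImage (f : X ≃ᵐ X) (k : ℤ) (B : Set X) : Set X :=
  ((f.toEquiv : Equiv.Perm X) ^ k : Equiv.Perm X) '' B

/-- `(X, μ, f)` is a dissipative system generated by `W`: the set `W` is measurable with
`0 < μ(W) < ∞`, and `X` is the disjoint union of the sets `f^k(W)`, `k ∈ ℤ`. -/
structure IsDissipativeGeneratedBy (f : X ≃ᵐ X) (μ : Measure X) (W : Set X) : Prop where
  measurableSet : MeasurableSet W
  measure_pos : 0 < μ W
  measure_lt_top : μ W < ∞
  pairwise_disjoint : Pairwise fun j k : ℤ => Disjoint (iterImage f j W) (iterImage f k W)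
  iUnion_eq_univ : ⋃ k : ℤ, iterImage f k W = Set.univ

/-- `f` is of bounded distortion on `W`. -/
def HasBoundedDistortionOn (f : X ≃ᵐ X) (μ : Measure X) (W : Set X) : Prop :=
  ∃ K : ℝ≥0, 0 < K ∧ ∀ k : ℤ, ∀ B : Set X, MeasurableSet B → B ⊆ W →
    (K : ℝ≥0∞)⁻¹ * (μ (iterImage f k W) * μ B) ≤ μ (iterImage f k B) * μ W ∧
    μ (iterImage f k B) * μ W ≤ K * (μ (iterImage f k W) * μ B)

/-! ### The three growth conditions

All quantities are taken in `[0, ∞]`, so suprema, infima and upper and lower limits always exist. -/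

/-- `limsup_n sup_{k ∈ ℤ} (μ(f^k W) / μ(f^{k+n} W))^{1/n} < 1`. -/
def ConditionHC (f : X ≃ᵐ X) (μ : Measure X) (W : Set X) : Prop :=
  limsup (fun n : ℕ => ⨆ k : ℤ,
    (μ (iterImage f k W) / μ (iterImage f (k + n) W)) ^ (1 / (n : ℝ))) atTop < 1

/-- `liminf_n inf_{k ∈ ℤ} (μ(f^k W) / μ(f^{k+n} W))^{1/n} > 1`. -/
def ConditionHD (f : X ≃ᵐ X) (μ : Measure X) (W : Set X) : Prop :=
  1 < liminf (fun n : ℕ => ⨅ k : ℤ,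
    (μ (iterImage f k W) / μ (iterImage f (k + n) W)) ^ (1 / (n : ℝ))) atTop

/-- `limsup_n sup_{k ≤ 0} (μ(f^{k-n} W) / μ(f^k W))^{1/n} < 1` and
`liminf_n inf_{k ≥ 0} (μ(f^k W) / μ(f^{k+n} W))^{1/n} > 1`. -/
def ConditionGH (f : X ≃ᵐ X) (μ : Measure X) (W : Set X) : Prop :=
  limsup (fun n : ℕ => ⨆ (k : ℤ) (_ : k ≤ 0),
    (μ (iterImage f (k - n) W) / μ (iterImage f k W)) ^ (1 / (n : ℝ))) atTop < 1 ∧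
  1 < liminf (fun n : ℕ => ⨅ (k : ℤ) (_ : 0 ≤ k),
    (μ (iterImage f k W) / μ (iterImage f (k + n) W)) ^ (1 / (n : ℝ))) atTop

end CompositionDynamics

end

/-!
Write `a k = μ(f^k W)`. Bounded distortion makes `T_f` behave like a bilateral backward shift on
blocks: up to the constant `K`, moving a function from the block `f^k(W)` to the block `f^{k-j}(W)`
by `T_f^j` multiplies the `p`-th power of its norm by `a (k - j) / a k`
(`restrict_map_iterEquiv_le`). Each of the three conditions says that the blocks split into a set
`S` of indices over which `a` decays geometrically to the left, so that `T_f` contracts functions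
living there, and a complement over which `a` decays geometrically to the right, so that `T_f⁻¹`
contracts: `S` is everything, nothing, or the half-line `k ≤ 0`.

Sufficiency. With `P` the restriction of functions to the blocks in `S`, the perturbed recursion
`y (n + 1) = T y n + z n` has the uniformly bounded solution
`∑ T^j P z_{n-1-j} - ∑ T^{-(j+1)} (1 - P) z_{n+j}`, which is the difference between a
pseudotrajectory and an orbit shadowing it (`hasShadowingProperty_of_summable_splitting`).

Necessity. Only one family of pseudotrajectories is tested, the multiples `s n • T^n 1_W` of a
single orbit, with `s (n + 1) - s n` proportional to `b (n + 1) = 1 / ‖T^(n+1) 1_W‖`. Averaging a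
shadowing orbit over `W` gives an increasing real sequence `u` with
`u (n + 1) - u n = b (n + 1)` and `|u n| ≤ C b n` (`HasShadowingProperty.exists_sum_le`). Hence the
increments of `u` are comparable to `|u|` from below, so `u` grows geometrically where it is
positive and decays geometrically in absolute value where it is negative, and `b` follows. The three
conditions correspond to `u ≥ 0`, `u ≤ 0`, and a change of sign
(`HasBoundedRatio.decays_of_abs_sum_le`).
-/

namespace CompositionDynamics

/-! ### Shadowing from a dichotomy of summable bounds -/

section Abstract

variable {𝕜 E : Type*} [NontriviallyNormedField 𝕜] [NormedAddCommGroup E] [NormedSpace 𝕜 E]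

/-- A splitting `z = P z + (z - P z)` whose first part is summably contracted by the forward
iterates of `T` and whose second part by the backward iterates gives shadowing. Neither linearity of
`P` nor invariance of its range is needed: the correction
`∑ⱼ T^j P z_{n-1-j} - ∑ⱼ T^{-(j+1)} (z_{n+j} - P z_{n+j})` solves `y_{n+1} = T y_n + z_n` by
telescoping. -/
theorem hasShadowingProperty_of_summable_splitting [CompleteSpace E] (T : E ≃L[𝕜] E) (P : E → E)
    {α β : ℕ → ℝ} (hα : Summable α) (hβ : Summable β) (hα0 : ∀ j, 0 ≤ α j) (hβ0 : ∀ j, 0 ≤ β j)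
    (hP : ∀ (j : ℕ) (z : E), ‖(T ^ (j : ℤ)) (P z)‖ ≤ α j * ‖z‖)
    (hQ : ∀ (j : ℕ) (z : E), ‖(T ^ (-((j : ℤ) + 1))) (z - P z)‖ ≤ β j * ‖z‖) :
    HasShadowingProperty T := by
  have hTadd : ∀ (m : ℤ) (v : E), T ((T ^ m) v) = (T ^ (m + 1)) v := fun m v => by
    rw [add_comm, zpow_one_add]; rfl
  intro ε hε
  set R : ℝ := |∑' j, α j| + |∑' j, β j| + 1 with hR
  have hRpos : 0 < R := by positivity
  refine ⟨ε / (2 * R), by positivity, fun x hx => ?_⟩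
  set δ : ℝ := ε / (2 * R) with hδ
  have hδpos : 0 < δ := by positivity
  let z : ℤ → E := fun n => x (n + 1) - T (x n)
  have hz : ∀ n, ‖z n‖ ≤ δ := fun n => by
    have := hx n
    rwa [norm_sub_rev] at this
  have hPz : ∀ (j : ℕ) (n : ℤ), ‖(T ^ (j : ℤ)) (P (z n))‖ ≤ α j * δ := fun j n =>
    (hP j _).trans (mul_le_mul_of_nonneg_left (hz n) (hα0 j))
  have hQz : ∀ (j : ℕ) (n : ℤ), ‖(T ^ (-((j : ℤ) + 1))) (z n - P (z n))‖ ≤ β j * δ := fun j n =>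
    (hQ j _).trans (mul_le_mul_of_nonneg_left (hz n) (hβ0 j))
  let p : ℤ → ℕ → E := fun n j => (T ^ (j : ℤ)) (P (z (n - 1 - j)))
  let q : ℤ → ℕ → E := fun n j => (T ^ (-((j : ℤ) + 1))) (z (n + j) - P (z (n + j)))
  have hp : ∀ n, Summable (p n) := fun n =>
    Summable.of_norm_bounded (hα.mul_right δ) fun j => hPz j _
  have hq : ∀ n, Summable (q n) := fun n =>
    Summable.of_norm_bounded (hβ.mul_right δ) fun j => hQz j _
  let y : ℤ → E := fun n => ∑' j, p n j - ∑' j, q n j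
  have hy : ∀ n, y (n + 1) = T (y n) + z n := fun n => by
    have h1 : ∑' j, p (n + 1) j = P (z n) + T (∑' j, p n j) := by
      rw [(hp (n + 1)).tsum_eq_zero_add, T.map_tsum]
      congr 1
      · simp [p]
        rfl
      · refine tsum_congr fun j => ?_
        simp only [p, hTadd]
        push_cast
        congr 3
        ring_nf
    have h2 : T (∑' j, q n j) = (z n - P (z n)) + ∑' j, q (n + 1) j := by
      rw [T.map_tsum, Summable.tsum_eq_zero_add (T.summable.2 (hq n))]
      congr 1
      · simp only [q, hTadd]
        simp
        rfl
      · refine tsum_congr fun j => ?_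
        simp only [q, hTadd]
        push_cast
        rw [show n + ((j : ℤ) + 1) = n + 1 + j by ring]
        congr 2
    simp only [y, map_sub, h1, h2]
    abel
  have hyn : ∀ n, ‖y n‖ < ε := fun n => by
    have h1 : ‖∑' j, p n j‖ ≤ (∑' j, α j) * δ := by
      rw [← tsum_mul_right]
      exact tsum_of_norm_bounded (hα.mul_right δ).hasSum fun j => hPz j _
    have h2 : ‖∑' j, q n j‖ ≤ (∑' j, β j) * δ := by
      rw [← tsum_mul_right]
      exact tsum_of_norm_bounded (hβ.mul_right δ).hasSum fun j => hQz j _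
    calc ‖y n‖ ≤ ‖∑' j, p n j‖ + ‖∑' j, q n j‖ := norm_sub_le _ _
      _ ≤ (∑' j, α j) * δ + (∑' j, β j) * δ := add_le_add h1 h2
      _ ≤ R * δ := by
        rw [← add_mul]
        refine mul_le_mul_of_nonneg_right ?_ hδpos.le
        linarith [le_abs_self (∑' j, α j), le_abs_self (∑' j, β j)]
      _ = ε / 2 := by rw [hδ]; field_simp
      _ < ε := half_lt_self hε
  have hstep : ∀ n, x (n + 1) - y (n + 1) = T (x n - y n) := fun n => by
    rw [hy, T.map_sub (x n)]
    change x (n + 1) - (T (y n) + (x (n + 1) - T (x n))) = T (x n) - T (y n)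
    abel
  have horbit : ∀ n : ℤ, (T ^ n) (x 0 - y 0) = x n - y n := fun n => by
    induction n with
    | zero => rw [zpow_zero]; rfl
    | succ n ih => rw [hstep, ← ih, hTadd]
    | pred n ih =>
      apply T.injective
      rw [hTadd, ← hstep, sub_add_cancel, ih]
  refine ⟨x 0 - y 0, fun n => ?_⟩
  rw [horbit, sub_sub_cancel_left, norm_neg]
  exact hyn n

/-- Every function on `ℤ` is a forward difference. -/
theorem exists_forward_difference_eq {M : Type*} [AddCommGroup M] (g : ℤ → M) :
    ∃ s : ℤ → M, ∀ n, s (n + 1) - s n = g n := by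
  refine ⟨fun n => ∑ i ∈ Finset.Ico 0 n, g i - ∑ i ∈ Finset.Ico n 0, g i, fun n => ?_⟩
  beta_reduce
  rcases lt_or_ge n 0 with hn | hn
  · rw [Finset.Ico_eq_empty (by omega : ¬ 0 < n + 1),
      Finset.Ico_eq_empty (by omega : ¬ (0 : ℤ) < n),
      ← Finset.sum_Ioo_add_eq_sum_Ico hn,
      show Finset.Ioo n 0 = Finset.Ico (n + 1) 0 by ext; simp]
    simp
  · rw [Finset.Ico_eq_empty (by omega : ¬ n + 1 < 0), Finset.Ico_eq_empty (by omega : ¬ n < 0),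
      show Finset.Ico 0 (n + 1) = Finset.Icc 0 n by ext; simp,
      ← Finset.sum_Ico_add_eq_sum_Icc hn]
    simp

end Abstract

/-- Testing shadowing along one orbit `T^n e`. If the functionals `L ∘ T^{-n}` have norm of order
`b n`, where `b n` is at most the inverse of `‖T^n e‖`, the pseudotrajectory `s n • T^n e` with
`s (n + 1) - s n = δ * b (n + 1)` is shadowed by the orbit of some `y`, and `s n - L y` is then of
order `b n`. -/
theorem HasShadowingProperty.exists_sum_le {𝕜 E : Type*} [RCLike 𝕜] [NormedAddCommGroup E]
    [NormedSpace 𝕜 E] {T : E ≃L[𝕜] E} (hT : HasShadowingProperty T) (e : E) (L : E →ₗ[𝕜] 𝕜)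
    (hLe : L e = 1) {b : ℤ → ℝ} (hb : ∀ n, 0 < b n) (he : ∀ n : ℤ, b n * ‖(T ^ n) e‖ ≤ 1) {D : ℝ}
    (hL : ∀ (n : ℤ) (v : E), ‖L ((T ^ (-n)) v)‖ ≤ D * b n * ‖v‖) :
    ∃ C : ℝ, 0 < C ∧ ∃ u : ℤ → ℝ, (∀ n, u (n + 1) - u n = b (n + 1)) ∧ ∀ n, |u n| ≤ C * b n := by
  obtain ⟨δ, hδ, h⟩ := hT 1 one_pos
  obtain ⟨s, hs⟩ := exists_forward_difference_eq fun n : ℤ => b (n + 1)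
  have hTadd : ∀ (m : ℤ) (v : E), T ((T ^ m) v) = (T ^ (m + 1)) v := fun m v => by
    rw [add_comm, zpow_one_add]; rfl
  obtain ⟨y, hy⟩ := h (fun n => ((δ * s n : ℝ) : 𝕜) • (T ^ n) e) fun n => by
    rw [map_smul, hTadd, ← sub_smul, ← RCLike.ofReal_sub, norm_smul, RCLike.norm_ofReal,
      ← mul_sub, abs_mul, abs_of_pos hδ, abs_sub_comm, hs, abs_of_pos (hb _), mul_assoc]
    exact (mul_le_mul_of_nonneg_left (he _) hδ.le).trans_eq (mul_one δ)
  refine ⟨(|D| + 1) / δ, by positivity, fun n => s n - RCLike.re (L y) / δ, fun n => ?_,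
    fun n => ?_⟩
  · rw [← hs]; ring
  · have h1 := hL n ((T ^ n) y - ((δ * s n : ℝ) : 𝕜) • (T ^ n) e)
    have hcancel : ∀ v, (T ^ (-n)) ((T ^ n) v) = v := fun v => by
      change ((T ^ (-n)) * (T ^ n)) v = v
      rw [← zpow_add, neg_add_cancel, zpow_zero]; rfl
    rw [map_sub, map_smul, hcancel, hcancel, map_sub, map_smul, hLe, smul_eq_mul, mul_one] at h1
    have h2 : |RCLike.re (L y) - δ * s n| ≤ (|D| + 1) * b n := by
      have h3 := RCLike.abs_re_le_norm (L y - ((δ * s n : ℝ) : 𝕜))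
      rw [map_sub, RCLike.ofReal_re] at h3
      refine h3.trans (h1.trans ?_)
      calc D * b n * ‖(T ^ n) y - ((δ * s n : ℝ) : 𝕜) • (T ^ n) e‖
          ≤ (|D| + 1) * b n * ‖(T ^ n) y - ((δ * s n : ℝ) : 𝕜) • (T ^ n) e‖ := by
            gcongr
            · exact (hb n).le
            · linarith [le_abs_self D]
        _ ≤ (|D| + 1) * b n * 1 := by
            have := (hb n).le
            gcongr
            exact (hy n).le
        _ = _ := mul_one _
    rw [abs_sub_comm] at h2
    have h4 : s n - RCLike.re (L y) / δ = (δ * s n - RCLike.re (L y)) / δ := by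
      field_simp
    beta_reduce
    rw [h4, abs_div, abs_of_pos hδ, div_le_iff₀ hδ]
    calc _ ≤ _ := h2
      _ = _ := by field_simp

/-! ### Geometric decay of positive two-sided sequences -/

section Scalar

variable {b u : ℤ → ℝ} {C : ℝ}

/-- The bound `u n ≤ C * b n = C * (u n - u (n - 1))` makes `u` shrink by the factor `C / (C + 1)`
at each step to the left; as long as `u` stays nonnegative it dominates its increments `b`. -/
theorem sub_le_of_abs_sum_le (hC : 0 < C) (hb : ∀ n, 0 < b n)
    (hu : ∀ n, u (n + 1) - u n = b (n + 1)) (hub : ∀ n, |u n| ≤ C * b n) (n : ℤ) (j : ℕ)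
    (hnj : 0 ≤ u (n - j - 1)) : b (n - j) ≤ C * (C / (C + 1)) ^ j * b n := by
  have hstep : ∀ m, u (m - 1) ≤ C / (C + 1) * u m := fun m => by
    have h1 := hu (m - 1)
    rw [sub_add_cancel] at h1
    have h2 := (le_abs_self _).trans (hub m)
    have h3 := hb m
    rw [div_mul_eq_mul_div, le_div_iff₀ (by positivity)]
    nlinarith
  have hiter : ∀ j : ℕ, u (n - j) ≤ (C / (C + 1)) ^ j * u n := fun j => by
    induction j with
    | zero => simp
    | succ j ih =>
      calc u (n - (j + 1 : ℕ)) = u (n - j - 1) := by push_cast; congr 1; ring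
        _ ≤ C / (C + 1) * u (n - j) := hstep _
        _ ≤ C / (C + 1) * ((C / (C + 1)) ^ j * u n) := by gcongr
        _ = _ := by ring
  have h1 := hu (n - j - 1)
  rw [sub_add_cancel] at h1
  calc b (n - j) ≤ u (n - j) := by linarith
    _ ≤ (C / (C + 1)) ^ j * u n := hiter j
    _ ≤ (C / (C + 1)) ^ j * (C * b n) := by
      gcongr
      exact (le_abs_self _).trans (hub n)
    _ = _ := by ring

/-- The mirror image of `sub_le_of_abs_sum_le`: `-u` shrinks by the factor `C / (C + 1)` at each
step to the right, and dominates `b` as long as it stays nonnegative. -/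
theorem add_le_of_abs_sum_le (hC : 0 < C)
    (hu : ∀ n, u (n + 1) - u n = b (n + 1)) (hub : ∀ n, |u n| ≤ C * b n) (n : ℤ) (j : ℕ)
    (hnj : u (n + j) ≤ 0) : b (n + j) ≤ (C + 1) * (C / (C + 1)) ^ j * b n := by
  have hstep : ∀ m, -u (m + 1) ≤ C / (C + 1) * -u m := fun m => by
    have h1 := hu m
    have h2 := (neg_abs_le (u (m + 1)))
    have h3 := hub (m + 1)
    rw [div_mul_eq_mul_div, le_div_iff₀ (by positivity)]
    nlinarith
  have hiter : ∀ j : ℕ, -u (n - 1 + j) ≤ (C / (C + 1)) ^ j * -u (n - 1) := fun j => by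
    induction j with
    | zero => simp
    | succ j ih =>
      calc -u (n - 1 + (j + 1 : ℕ)) = -u (n - 1 + j + 1) := by push_cast; congr 2; ring
        _ ≤ C / (C + 1) * -u (n - 1 + j) := hstep _
        _ ≤ C / (C + 1) * ((C / (C + 1)) ^ j * -u (n - 1)) := by gcongr
        _ = _ := by ring
  have h1 := hu (n - 1 + j)
  rw [show n - 1 + (j : ℤ) + 1 = n + j by ring] at h1
  have h2 := hu (n - 1)
  rw [sub_add_cancel] at h2
  calc b (n + j) ≤ -u (n - 1 + j) := by linarith
    _ ≤ (C / (C + 1)) ^ j * -u (n - 1) := hiter j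
    _ ≤ (C / (C + 1)) ^ j * ((C + 1) * b n) := by
      gcongr
      linarith [neg_abs_le (u n), hub n]
    _ = _ := by ring

end Scalar

/-- `a (k - n)` is at most a geometrically small multiple of `a k`, uniformly in `k ∈ S`. -/
def DecaysLeft (a : ℤ → ℝ≥0∞) (S : Set ℤ) : Prop :=
  ∃ C t : ℝ≥0, t < 1 ∧ ∀ k ∈ S, ∀ n : ℕ, a (k - n) ≤ C * t ^ n * a k

/-- `a (k + n)` is at most a geometrically small multiple of `a k`, uniformly in `k ∈ S`. -/
def DecaysRight (a : ℤ → ℝ≥0∞) (S : Set ℤ) : Prop :=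
  ∃ C t : ℝ≥0, t < 1 ∧ ∀ k ∈ S, ∀ n : ℕ, a (k + n) ≤ C * t ^ n * a k

/-- The terms of `a` are positive and finite, and the ratio of consecutive terms is bounded above
and below. -/
structure HasBoundedRatio (a : ℤ → ℝ≥0∞) (c : ℝ≥0) : Prop where
  ne_zero : ∀ k, a k ≠ 0
  ne_top : ∀ k, a k ≠ ∞
  pred_le : ∀ k, a (k - 1) ≤ c * a k
  succ_le : ∀ k, a (k + 1) ≤ c * a k

namespace HasBoundedRatio

variable {a : ℤ → ℝ≥0∞} {c : ℝ≥0} (h : HasBoundedRatio a c)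
include h

theorem sub_le (k : ℤ) (n : ℕ) : a (k - n) ≤ c ^ n * a k := by
  induction n with
  | zero => simp
  | succ n ih =>
    calc a (k - (n + 1 : ℕ)) = a (k - n - 1) := by push_cast; congr 1; ring
      _ ≤ c * a (k - n) := h.pred_le _
      _ ≤ c * (c ^ n * a k) := by gcongr
      _ = _ := by ring

theorem add_le (k : ℤ) (n : ℕ) : a (k + n) ≤ c ^ n * a k := by
  induction n with
  | zero => simp
  | succ n ih =>
    calc a (k + (n + 1 : ℕ)) = a (k + n + 1) := by push_cast; congr 1; ring
      _ ≤ c * a (k + n) := h.succ_le _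
      _ ≤ c * (c ^ n * a k) := by gcongr
      _ = _ := by ring

/-- A bounded shift of the half-line only changes the constant. -/
theorem decaysLeft_Iic {M : ℕ} (hd : DecaysLeft a (Set.Iic (-M))) : DecaysLeft a (Set.Iic 0) := by
  obtain ⟨C, t, ht, hC⟩ := hd
  refine ⟨c ^ M * C * c ^ M, t, ht, fun k hk n => ?_⟩
  have hk' : k ≤ 0 := hk
  calc a (k - n) = a (k - M - n + M) := by congr 1; ring
    _ ≤ c ^ M * a (k - M - n) := h.add_le _ _
    _ ≤ c ^ M * (C * t ^ n * a (k - M)) := by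
      gcongr
      exact hC _ (by simp; omega) _
    _ ≤ c ^ M * (C * t ^ n * (c ^ M * a k)) := by
      gcongr
      exact h.sub_le _ _
    _ = _ := by push_cast; ring

theorem decaysRight_Ici {M : ℕ} (hd : DecaysRight a (Set.Ici (M : ℤ))) :
    DecaysRight a (Set.Ici 0) := by
  obtain ⟨C, t, ht, hC⟩ := hd
  refine ⟨c ^ M * C * c ^ M, t, ht, fun k hk n => ?_⟩
  have hk' : 0 ≤ k := hk
  calc a (k + n) = a (k + M + n - M) := by congr 1; ring
    _ ≤ c ^ M * a (k + M + n) := h.sub_le _ _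
    _ ≤ c ^ M * (C * t ^ n * a (k + M)) := by
      gcongr
      exact hC _ (by simp; omega) _
    _ ≤ c ^ M * (C * t ^ n * (c ^ M * a k)) := by
      gcongr
      exact h.add_le _ _
    _ = _ := by push_cast; ring

end HasBoundedRatio

/-- Passing from `b = a ^ (-1 / p)` back to `a` reverses the inequality and keeps the geometric
rate. -/
theorem le_of_rpow_neg_le {x y : ℝ≥0∞} (hx0 : x ≠ 0) (hx : x ≠ ∞) (hy0 : y ≠ 0) (hy : y ≠ ∞)
    {p : ℝ} (hp : 0 < p) {D q : ℝ≥0} {j : ℕ}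
    (h : x.toReal ^ (-(1 / p)) ≤ D * q ^ j * y.toReal ^ (-(1 / p))) :
    y ≤ (D ^ p : ℝ≥0) * (q ^ p : ℝ≥0) ^ j * x := by
  lift x to ℝ≥0 using hx
  lift y to ℝ≥0 using hy
  have hx0' : (0 : ℝ) < x := by
    have : x ≠ 0 := by simpa using hx0
    exact_mod_cast pos_iff_ne_zero.2 this
  have hy0' : (0 : ℝ) < y := by
    have : y ≠ 0 := by simpa using hy0
    exact_mod_cast pos_iff_ne_zero.2 this
  simp only [ENNReal.coe_toReal] at h
  norm_cast
  rw [← NNReal.coe_le_coe]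
  push_cast
  have h1 := Real.rpow_le_rpow (by positivity) h hp.le
  rw [Real.mul_rpow (by positivity) (by positivity), Real.mul_rpow (by positivity) (by positivity),
    ← Real.rpow_mul hx0'.le, ← Real.rpow_mul hy0'.le, ← Real.rpow_natCast,
    ← Real.rpow_mul q.coe_nonneg,
    mul_comm (j : ℝ) p, Real.rpow_mul q.coe_nonneg, Real.rpow_natCast] at h1
  have hpp : -(1 / p) * p = -1 := by field_simp
  rw [hpp, Real.rpow_neg_one, Real.rpow_neg_one, ← div_eq_mul_inv, le_div_iff₀ hy0',
    inv_mul_le_iff₀ hx0'] at h1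
  linarith

/-- If the increasing sequence `u` whose increments are the terms `b n = a (-n) ^ (-1 / p)` is
bounded by a multiple of `b`, then `a` decays geometrically: to the left if `u ≥ 0`, to the right if
`u ≤ 0`, and towards both ends if `u` changes sign. -/
theorem HasBoundedRatio.decays_of_abs_sum_le {a : ℤ → ℝ≥0∞} {c : ℝ≥0} (h : HasBoundedRatio a c)
    {p : ℝ} (hp : 0 < p) {u : ℤ → ℝ} {C : ℝ} (hC : 0 < C)
    (hu : ∀ n : ℤ, u (n + 1) - u n = (a (-(n + 1))).toReal ^ (-(1 / p)))
    (hub : ∀ n : ℤ, |u n| ≤ C * (a (-n)).toReal ^ (-(1 / p))) :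
    DecaysLeft a Set.univ ∨ DecaysRight a Set.univ ∨
      (DecaysLeft a (Set.Iic 0) ∧ DecaysRight a (Set.Ici 0)) := by
  have hb : ∀ n : ℤ, 0 < (a (-n)).toReal ^ (-(1 / p)) := fun n =>
    Real.rpow_pos_of_pos (ENNReal.toReal_pos (h.ne_zero _) (h.ne_top _)) _
  have hmono : Monotone u := monotone_int_of_le_succ fun n => by
    linarith [hu n, hb (n + 1)]
  lift C to ℝ≥0 using hC.le
  have hq : (C / (C + 1)) ^ p < 1 :=
    NNReal.rpow_lt_one ((div_lt_one (by positivity)).2 (by simp)) hp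
  have hleft : ∀ k : ℤ, ∀ n : ℕ, 0 ≤ u (-k - 1) →
      a (k - n) ≤ (C ^ p : ℝ≥0) * ((C / (C + 1)) ^ p : ℝ≥0) ^ n * a k := fun k n hk => by
    refine le_of_rpow_neg_le (h.ne_zero _) (h.ne_top _) (h.ne_zero _) (h.ne_top _) hp ?_
    have := sub_le_of_abs_sum_le (b := fun n => (a (-n)).toReal ^ (-(1 / p))) hC hb hu hub
      (-(k - n)) n (by rwa [show -(k - (n : ℤ)) - n - 1 = -k - 1 by ring])
    rw [neg_neg, show -(-(k - (n : ℤ)) - n) = k by ring] at this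
    push_cast
    exact this
  have hright : ∀ k : ℤ, ∀ n : ℕ, u (-k) ≤ 0 →
      a (k + n) ≤ ((C + 1) ^ p : ℝ≥0) * ((C / (C + 1)) ^ p : ℝ≥0) ^ n * a k := fun k n hk => by
    refine le_of_rpow_neg_le (h.ne_zero _) (h.ne_top _) (h.ne_zero _) (h.ne_top _) hp ?_
    have := add_le_of_abs_sum_le (b := fun n => (a (-n)).toReal ^ (-(1 / p))) hC hu hub
      (-(k + n)) n (by rwa [show -(k + (n : ℤ)) + n = -k by ring])
    rw [neg_neg, show -(-(k + (n : ℤ)) + n) = k by ring] at this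
    push_cast
    exact this
  by_cases h1 : ∀ n, 0 ≤ u n
  · exact Or.inl ⟨_, _, hq, fun k _ n => hleft k n (h1 _)⟩
  by_cases h2 : ∀ n, u n ≤ 0
  · exact Or.inr (Or.inl ⟨_, _, hq, fun k _ n => hright k n (h2 _)⟩)
  push Not at h1 h2
  obtain ⟨m₁, hm₁⟩ := h1
  obtain ⟨m₂, hm₂⟩ := h2
  refine Or.inr (Or.inr ⟨h.decaysLeft_Iic (M := m₂.natAbs + 1) ⟨_, _, hq, fun k hk n =>
    hleft k n (hm₂.le.trans (hmono ?_))⟩, h.decaysRight_Ici (M := m₁.natAbs) ⟨_, _, hq,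
    fun k hk n => hright k n ((hmono ?_).trans hm₁.le)⟩⟩)
  · have : k ≤ -((m₂.natAbs + 1 : ℕ) : ℤ) := hk
    omega
  · have : (m₁.natAbs : ℤ) ≤ k := hk
    omega

/-! ### The growth conditions as geometric decay -/

/-- An upper limit of `n`-th roots below `1` is a uniform geometric bound. The a priori bound
`c ^ n` turns a bound for large `n` into one for all `n`. -/
theorem limsup_iSup_rpow_lt_one_iff {ι : Type*} {S : Set ι} {r : ℕ → ι → ℝ≥0∞} {c : ℝ≥0}
    (hc : ∀ n, ∀ k ∈ S, r n k ≤ c ^ n) :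
    limsup (fun n : ℕ => ⨆ k ∈ S, r n k ^ (1 / (n : ℝ))) atTop < 1 ↔
      ∃ C t : ℝ≥0, t < 1 ∧ ∀ k ∈ S, ∀ n : ℕ, r n k ≤ C * t ^ n := by
  constructor
  · intro h
    obtain ⟨t, ht, ht1⟩ := exists_between h
    lift t to ℝ≥0 using ht1.ne_top
    have ht0 : 0 < t := by exact_mod_cast pos_of_gt ht
    obtain ⟨N, hN⟩ := eventually_atTop.1 (eventually_lt_of_limsup_lt ht)
    -- The first `N` terms are controlled by `hc`.
    refine ⟨max 1 (c / t) ^ (N + 1), t, by exact_mod_cast ht1, fun k hk n => ?_⟩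
    rcases le_or_gt (N + 1) n with hn | hn
    · have h1 : r n k ^ (1 / (n : ℝ)) ≤ t :=
        (le_iSup₂ (f := fun k (_ : k ∈ S) => r n k ^ (1 / (n : ℝ))) k hk).trans
          (hN n (by omega)).le
      have hn0 : (n : ℝ) ≠ 0 := by
        have : n ≠ 0 := by omega
        exact_mod_cast this
      have h2 := ENNReal.rpow_le_rpow h1 (Nat.cast_nonneg n)
      rw [← ENNReal.rpow_mul, one_div, inv_mul_cancel₀ hn0, ENNReal.rpow_one,
        ENNReal.rpow_natCast] at h2
      refine h2.trans (le_mul_of_one_le_left' ?_)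
      rw [ENNReal.coe_pow]
      exact one_le_pow₀ (by exact_mod_cast le_max_left 1 (c / t))
    · refine (hc n k hk).trans ?_
      norm_cast
      calc c ^ n = (c / t) ^ n * t ^ n := by rw [← mul_pow, div_mul_cancel₀ _ ht0.ne']
        _ ≤ max 1 (c / t) ^ n * t ^ n := by gcongr; exact le_max_right _ _
        _ ≤ max 1 (c / t) ^ (N + 1) * t ^ n := by
          gcongr
          · exact le_max_left _ _
  · rintro ⟨C, t, ht, h⟩
    obtain ⟨s, hts, hs1⟩ := exists_between ht
    have hs0 : 0 < s := pos_of_gt hts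
    -- A slightly worse rate `s` absorbs the constant `C`.
    have hlim : Tendsto (fun n : ℕ => C * (t / s) ^ n) atTop (nhds (C * 0)) :=
      (NNReal.tendsto_pow_atTop_nhds_zero_of_lt_one ((div_lt_one hs0).2 hts)).const_mul C
    rw [mul_zero] at hlim
    refine lt_of_le_of_lt (limsup_le_of_le (by isBoundedDefault) ?_) (ENNReal.coe_lt_one_iff.2 hs1)
    filter_upwards [hlim.eventually_le_const one_pos, eventually_gt_atTop 0] with n hn hn0
    refine iSup₂_le fun k hk => ?_
    have hn0' : (n : ℝ) ≠ 0 := by exact_mod_cast hn0.ne'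
    have h1 : r n k ≤ (s : ℝ≥0∞) ^ (n : ℝ) := by
      rw [ENNReal.rpow_natCast]
      refine (h k hk n).trans ?_
      norm_cast
      rwa [div_pow, mul_div_assoc', div_le_one (by positivity)] at hn
    calc r n k ^ (1 / (n : ℝ)) ≤ ((s : ℝ≥0∞) ^ (n : ℝ)) ^ (1 / (n : ℝ)) :=
          ENNReal.rpow_le_rpow h1 (by positivity)
      _ = s := by rw [← ENNReal.rpow_mul, mul_one_div_cancel hn0', ENNReal.rpow_one]

theorem one_lt_liminf_iInf_rpow_iff {ι : Type*} {S : Set ι} {r : ℕ → ι → ℝ≥0∞} :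
    1 < liminf (fun n : ℕ => ⨅ k ∈ S, r n k ^ (1 / (n : ℝ))) atTop ↔
      limsup (fun n : ℕ => ⨆ k ∈ S, (r n k)⁻¹ ^ (1 / (n : ℝ))) atTop < 1 := by
  rw [← ENNReal.inv_lt_inv, inv_one, ENNReal.inv_liminf]
  simp only [ENNReal.inv_iInf, ENNReal.inv_rpow]

namespace HasBoundedRatio

variable {a : ℤ → ℝ≥0∞} {c : ℝ≥0} (h : HasBoundedRatio a c)
include h

theorem decaysLeft_iff (S : Set ℤ) : DecaysLeft a S ↔
    limsup (fun n : ℕ => ⨆ k ∈ S, (a (k - n) / a k) ^ (1 / (n : ℝ))) atTop < 1 := by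
  rw [limsup_iSup_rpow_lt_one_iff (c := c) fun n k _ => ENNReal.div_le_of_le_mul (h.sub_le k n)]
  simp only [DecaysLeft, ENNReal.div_le_iff (h.ne_zero _) (h.ne_top _)]

theorem decaysRight_iff (S : Set ℤ) : DecaysRight a S ↔
    1 < liminf (fun n : ℕ => ⨅ k ∈ S, (a k / a (k + n)) ^ (1 / (n : ℝ))) atTop := by
  rw [one_lt_liminf_iInf_rpow_iff]
  simp only [ENNReal.inv_div (Or.inl (h.ne_top _)) (Or.inl (h.ne_zero _))]
  rw [limsup_iSup_rpow_lt_one_iff (c := c) fun n k _ => ENNReal.div_le_of_le_mul (h.add_le k n)]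
  simp only [DecaysRight, ENNReal.div_le_iff (h.ne_zero _) (h.ne_top _)]

end HasBoundedRatio

section Conditions

variable {X : Type*} [MeasurableSpace X] {f : X ≃ᵐ X} {μ : Measure X} {W : Set X} {c : ℝ≥0}

theorem conditionHC_iff (h : HasBoundedRatio (fun k => μ (iterImage f k W)) c) :
    ConditionHC f μ W ↔ DecaysLeft (fun k => μ (iterImage f k W)) Set.univ := by
  rw [h.decaysLeft_iff, ConditionHC]
  have : ∀ n : ℕ, (⨆ k : ℤ,
      (μ (iterImage f k W) / μ (iterImage f (k + n) W)) ^ (1 / (n : ℝ))) =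
      ⨆ k ∈ (Set.univ : Set ℤ),
        (μ (iterImage f (k - n) W) / μ (iterImage f k W)) ^ (1 / (n : ℝ)) := fun n => by
    rw [← (Equiv.subRight (n : ℤ)).iSup_comp]
    simp
  simp only [this]

theorem conditionHD_iff (h : HasBoundedRatio (fun k => μ (iterImage f k W)) c) :
    ConditionHD f μ W ↔ DecaysRight (fun k => μ (iterImage f k W)) Set.univ := by
  rw [h.decaysRight_iff, ConditionHD]
  simp

theorem conditionGH_iff (h : HasBoundedRatio (fun k => μ (iterImage f k W)) c) :
    ConditionGH f μ W ↔ DecaysLeft (fun k => μ (iterImage f k W)) (Set.Iic 0) ∧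
      DecaysRight (fun k => μ (iterImage f k W)) (Set.Ici 0) := by
  rw [h.decaysLeft_iff, h.decaysRight_iff]
  rfl

end Conditions

/-! ### Integer iterates -/

section Iterates

variable {X : Type*} [MeasurableSpace X] (f : X ≃ᵐ X)

theorem measurable_zpow (k : ℤ) :
    Measurable ((f.toEquiv : Equiv.Perm X) ^ k : Equiv.Perm X) := by
  induction k with
  | zero => rw [zpow_zero]; exact measurable_id
  | succ n ih => rw [zpow_add_one]; exact ih.comp f.measurable
  | pred n ih => rw [zpow_sub_one]; exact ih.comp f.symm.measurable

/-- The iterate `f ^ k`, `k ∈ ℤ`, as a measurable equivalence. -/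
def iterEquiv (k : ℤ) : X ≃ᵐ X where
  toEquiv := (f.toEquiv : Equiv.Perm X) ^ k
  measurable_toFun := measurable_zpow f k
  measurable_invFun := by
    have h := measurable_zpow f (-k)
    rwa [zpow_neg] at h

theorem iterEquiv_zero (x : X) : iterEquiv f 0 x = x := rfl

theorem iterEquiv_add (j k : ℤ) (x : X) :
    iterEquiv f (j + k) x = iterEquiv f j (iterEquiv f k x) := by
  change ((f.toEquiv : Equiv.Perm X) ^ (j + k)) x = _
  rw [zpow_add]
  rfl

theorem iterEquiv_one (x : X) : iterEquiv f 1 x = f x := by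
  change ((f.toEquiv : Equiv.Perm X) ^ (1 : ℤ)) x = _
  rw [zpow_one]
  rfl

theorem iterEquiv_neg_one (x : X) : iterEquiv f (-1) x = f.symm x := by
  change ((f.toEquiv : Equiv.Perm X) ^ (-1 : ℤ)) x = _
  rw [zpow_neg_one]
  rfl

theorem iterImage_eq_preimage (k : ℤ) (B : Set X) :
    iterImage f k B = iterEquiv f (-k) ⁻¹' B := by
  ext x
  constructor
  · rintro ⟨y, hy, rfl⟩
    change iterEquiv f (-k) (iterEquiv f k y) ∈ B
    rwa [← iterEquiv_add, neg_add_cancel]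
  · intro hx
    refine ⟨iterEquiv f (-k) x, hx, ?_⟩
    change iterEquiv f k (iterEquiv f (-k) x) = x
    rw [← iterEquiv_add, add_neg_cancel, iterEquiv_zero]

theorem iterImage_zero (B : Set X) : iterImage f 0 B = B := by
  rw [iterImage_eq_preimage]
  rfl

theorem preimage_iterImage (j k : ℤ) (B : Set X) :
    iterEquiv f j ⁻¹' iterImage f k B = iterImage f (k - j) B := by
  ext x
  simp only [iterImage_eq_preimage, Set.mem_preimage, ← iterEquiv_add]
  rw [neg_sub, sub_eq_neg_add]

theorem measurableSet_iterImage (k : ℤ) {B : Set X} (hB : MeasurableSet B) :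
    MeasurableSet (iterImage f k B) := by
  rw [iterImage_eq_preimage]
  exact (iterEquiv f (-k)).measurable hB

theorem iterEquiv_quasiMeasurePreserving {f : X ≃ᵐ X} {μ : Measure X} (hf : CompositionBound f μ)
    (hf' : CompositionBound f.symm μ) (k : ℤ) :
    Measure.QuasiMeasurePreserving (iterEquiv f k) μ μ := by
  induction k with
  | zero => exact Measure.QuasiMeasurePreserving.id μ
  | succ n ih =>
    have h : ⇑(iterEquiv f (n + 1)) = iterEquiv f n ∘ f := by
      ext x; rw [iterEquiv_add, iterEquiv_one]; rfl
    rw [h]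
    exact ih.comp hf.quasiMeasurePreserving
  | pred n ih =>
    have h : ⇑(iterEquiv f (-n - 1)) = iterEquiv f (-n) ∘ f.symm := by
      ext x; rw [sub_eq_add_neg, iterEquiv_add, iterEquiv_neg_one]; rfl
    rw [h]
    exact ih.comp hf'.quasiMeasurePreserving

/-- The bounds on `f` and `f⁻¹` control consecutive blocks, starting from `0 < μ W < ∞`. -/
theorem exists_hasBoundedRatio {f : X ≃ᵐ X} {μ : Measure X} {W : Set X}
    (hf : CompositionBound f μ) (hf' : CompositionBound f.symm μ)
    (hW : IsDissipativeGeneratedBy f μ W) :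
    ∃ c : ℝ≥0, HasBoundedRatio (fun k => μ (iterImage f k W)) c := by
  obtain ⟨c, -, hc⟩ := hf
  obtain ⟨c', -, hc'⟩ := hf'
  have hpred : ∀ k, μ (iterImage f (k - 1) W) ≤ c * μ (iterImage f k W) := fun k => by
    have h := hc _ (measurableSet_iterImage f k hW.measurableSet)
    rwa [show ⇑f = iterEquiv f 1 from funext fun x => (iterEquiv_one f x).symm,
      preimage_iterImage] at h
  have hsucc : ∀ k, μ (iterImage f (k + 1) W) ≤ c' * μ (iterImage f k W) := fun k => by
    have h := hc' _ (measurableSet_iterImage f k hW.measurableSet)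
    rwa [show ⇑f.symm = iterEquiv f (-1) from funext fun x => (iterEquiv_neg_one f x).symm,
      preimage_iterImage, sub_neg_eq_add] at h
  have hzero : ∀ k, μ (iterImage f k W) ≠ 0 := fun k => by
    induction k with
    | zero => rw [iterImage_zero]; exact hW.measure_pos.ne'
    | succ n ih =>
      intro h0
      have h := hpred (n + 1)
      rw [h0, mul_zero, add_sub_cancel_right] at h
      exact ih (le_zero_iff.1 h)
    | pred n ih =>
      intro h0
      have h := hsucc (-n - 1)
      rw [h0, mul_zero, sub_add_cancel] at h
      exact ih (le_zero_iff.1 h)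
  have htop : ∀ k, μ (iterImage f k W) ≠ ∞ := fun k => by
    induction k with
    | zero => rw [iterImage_zero]; exact hW.measure_lt_top.ne
    | succ n ih => exact ne_top_of_le_ne_top (ENNReal.mul_ne_top ENNReal.coe_ne_top ih) (hsucc _)
    | pred n ih => exact ne_top_of_le_ne_top (ENNReal.mul_ne_top ENNReal.coe_ne_top ih) (hpred _)
  refine ⟨max c c', hzero, htop, fun k => (hpred k).trans ?_, fun k => (hsucc k).trans ?_⟩
  · gcongr
    exact le_max_left _ _
  · gcongr
    exact le_max_right _ _

/-- Bounded distortion transfers a bound on the ratios `μ(f^{k-j} W) / μ(f^k W)`, `k ∈ S`, to all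
measurable subsets of `⋃_{k ∈ S} f^k(W)`. -/
theorem restrict_map_iterEquiv_le {f : X ≃ᵐ X} {μ : Measure X} {W : Set X}
    (hW : IsDissipativeGeneratedBy f μ W) {K : ℝ≥0} (hK0 : 0 < K)
    (hK : ∀ k : ℤ, ∀ B : Set X, MeasurableSet B → B ⊆ W →
      (K : ℝ≥0∞)⁻¹ * (μ (iterImage f k W) * μ B) ≤ μ (iterImage f k B) * μ W ∧
      μ (iterImage f k B) * μ W ≤ K * (μ (iterImage f k W) * μ B))
    {S : Set ℤ} {A : Set X} (hA : MeasurableSet A) (hAS : A ⊆ ⋃ k ∈ S, iterImage f k W)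
    {j : ℤ} {M : ℝ≥0}
    (hM : ∀ k ∈ S, μ (iterImage f (k - j) W) ≤ M * μ (iterImage f k W)) :
    (μ.map (iterEquiv f j)).restrict A ≤ ((K ^ 2 * M : ℝ≥0) : ℝ≥0∞) • μ := by
  have hpiece : ∀ k ∈ S, ∀ C : Set X, MeasurableSet C → C ⊆ iterImage f k W →
      μ (iterEquiv f j ⁻¹' C) ≤ ((K ^ 2 * M : ℝ≥0) : ℝ≥0∞) * μ C := fun k hk C hC hCW => by
    set B := iterEquiv f k ⁻¹' C with hB
    have hBW : B ⊆ W := fun x hx => by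
      have h := hCW hx
      rwa [← Set.mem_preimage, preimage_iterImage, sub_self, iterImage_zero] at h
    have hBm : MeasurableSet B := (iterEquiv f k).measurable hC
    have h1 : iterImage f k B = C := by
      rw [iterImage_eq_preimage]
      ext x
      rw [hB, Set.mem_preimage, Set.mem_preimage, ← iterEquiv_add, add_neg_cancel, iterEquiv_zero]
    have h2 : iterImage f (k - j) B = iterEquiv f j ⁻¹' C := by
      rw [← preimage_iterImage, h1]
    have hl := (hK k B hBm hBW).1
    have hr := (hK (k - j) B hBm hBW).2
    rw [h1, ENNReal.inv_mul_le_iff (by simpa using hK0.ne') ENNReal.coe_ne_top] at hl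
    rw [h2] at hr
    rw [← ENNReal.mul_le_mul_iff_left hW.measure_pos.ne' hW.measure_lt_top.ne]
    calc μ (iterEquiv f j ⁻¹' C) * μ W ≤ K * (μ (iterImage f (k - j) W) * μ B) := hr
      _ ≤ K * (M * μ (iterImage f k W) * μ B) := by gcongr; exact hM k hk
      _ = K * (M * (μ (iterImage f k W) * μ B)) := by ring
      _ ≤ K * (M * (K * (μ C * μ W))) := by gcongr
      _ = ((K ^ 2 * M : ℝ≥0) : ℝ≥0∞) * μ C * μ W := by push_cast; ring
  refine Measure.le_iff.2 fun B hB => ?_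
  rw [Measure.restrict_apply hB, Measure.map_apply (iterEquiv f j).measurable (hB.inter hA)]
  have hunion : B ∩ A = ⋃ k : S, B ∩ A ∩ iterImage f k W := by
    rw [← Set.inter_iUnion, Set.iUnion_subtype]
    exact (Set.inter_eq_left.2 (Set.inter_subset_right.trans hAS)).symm
  have hdisj : Pairwise (Function.onFun Disjoint fun k : S => B ∩ A ∩ iterImage f k W) :=
    fun k l hkl => (hW.pairwise_disjoint (Subtype.coe_injective.ne hkl)).mono
      Set.inter_subset_right Set.inter_subset_right
  have hmeas : ∀ k : S, MeasurableSet (B ∩ A ∩ iterImage f k W) := fun k =>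
    (hB.inter hA).inter (measurableSet_iterImage f k hW.measurableSet)
  calc μ (iterEquiv f j ⁻¹' (B ∩ A))
      = μ (⋃ k : S, iterEquiv f j ⁻¹' (B ∩ A ∩ iterImage f k W)) := by
        rw [← Set.preimage_iUnion, ← hunion]
    _ ≤ ∑' k : S, μ (iterEquiv f j ⁻¹' (B ∩ A ∩ iterImage f k W)) := measure_iUnion_le _
    _ ≤ ∑' k : S, ((K ^ 2 * M : ℝ≥0) : ℝ≥0∞) * μ (B ∩ A ∩ iterImage f k W) :=
        ENNReal.tsum_le_tsum fun k => hpiece k k.2 _ (hmeas k) Set.inter_subset_right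
    _ = ((K ^ 2 * M : ℝ≥0) : ℝ≥0∞) * μ (B ∩ A) := by
        rw [ENNReal.tsum_mul_left, ← measure_iUnion hdisj hmeas, ← hunion]
    _ ≤ (((K ^ 2 * M : ℝ≥0) : ℝ≥0∞) • μ) B := by
        rw [Measure.smul_apply, smul_eq_mul]
        gcongr
        exact Set.inter_subset_left

end Iterates

/-! ### Powers of the composition operator -/

section Operator

variable {X : Type*} [MeasurableSpace X] {μ : Measure X} {𝕜 : Type*} [RCLike 𝕜] {p : ℝ≥0∞}

theorem eLpNorm_le_of_measure_le {ν : Measure X} (hp : p ≠ ∞) {M : ℝ≥0}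
    (hν : ν ≤ (M : ℝ≥0∞) • μ) (φ : X → 𝕜) :
    eLpNorm φ p ν ≤ ((M ^ (1 / p).toReal : ℝ≥0) : ℝ≥0∞) * eLpNorm φ p μ := by
  refine (eLpNorm_mono_measure φ hν).trans_eq ?_
  rw [eLpNorm_smul_measure_of_ne_top hp, smul_eq_mul,
    ENNReal.coe_rpow_of_nonneg _ ENNReal.toReal_nonneg]

/-- The restriction `φ ↦ 1_A φ` of an `L^p` function to a measurable set. -/
noncomputable def indicatorLp {A : Set X} (hA : MeasurableSet A) (φ : Lp 𝕜 p μ) : Lp 𝕜 p μ :=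
  ((Lp.memLp φ).indicator hA).toLp (A.indicator φ)

theorem sub_indicatorLp {A : Set X} (hA : MeasurableSet A) (φ : Lp 𝕜 p μ) :
    φ - indicatorLp hA φ = indicatorLp hA.compl φ := by
  apply Lp.ext
  filter_upwards [Lp.coeFn_sub φ (indicatorLp hA φ), ((Lp.memLp φ).indicator hA).coeFn_toLp,
    ((Lp.memLp φ).indicator hA.compl).coeFn_toLp] with x h1 h2 h3
  rw [h1, indicatorLp, indicatorLp, h3, Pi.sub_apply, h2, Set.indicator_compl]
  rfl

variable [Fact (1 ≤ p)] {f : X ≃ᵐ X}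

theorem coeFn_compositionOperator_zpow (hf : CompositionBound f μ)
    (hf' : CompositionBound f.symm μ) (n : ℤ) (φ : Lp 𝕜 p μ) :
    ((compositionOperator 𝕜 p hf hf') ^ n) φ =ᵐ[μ] φ ∘ iterEquiv f n := by
  induction n with
  | zero => exact ae_eq_refl _
  | succ n ih =>
    rw [add_comm, zpow_one_add]
    refine (coeFn_compositionOperator 𝕜 p hf hf' _).trans
      ((hf.quasiMeasurePreserving.ae_eq_comp ih).trans (ae_of_all _ fun x => ?_))
    simp only [Function.comp_apply]
    rw [add_comm (1 : ℤ), iterEquiv_add, iterEquiv_one]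
  | pred n ih =>
    rw [sub_eq_neg_add, zpow_add, zpow_neg_one]
    refine (coeFn_compositionMap 𝕜 p hf' _).trans
      ((hf'.quasiMeasurePreserving.ae_eq_comp ih).trans (ae_of_all _ fun x => ?_))
    simp only [Function.comp_apply]
    rw [add_comm (-1 : ℤ), iterEquiv_add, iterEquiv_neg_one]

/-- A change of variables: `‖T_f^j (1_A φ)‖^p` is the integral of `|φ|^p` over `A` against the
push-forward of `μ` under `f^j`. -/
theorem norm_compositionOperator_zpow_indicatorLp_le (hp : p ≠ ∞) (hf : CompositionBound f μ)
    (hf' : CompositionBound f.symm μ) {A : Set X} (hA : MeasurableSet A) {j : ℤ} {M : ℝ≥0}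
    (hM : (μ.map (iterEquiv f j)).restrict A ≤ (M : ℝ≥0∞) • μ) (φ : Lp 𝕜 p μ) :
    ‖((compositionOperator 𝕜 p hf hf') ^ j) (indicatorLp hA φ)‖ ≤
      ((M ^ (1 / p).toReal : ℝ≥0) : ℝ) * ‖φ‖ := by
  have hq := iterEquiv_quasiMeasurePreserving hf hf' j
  have h1 : eLpNorm (((compositionOperator 𝕜 p hf hf') ^ j) (indicatorLp hA φ)) p μ ≤
      ((M ^ (1 / p).toReal : ℝ≥0) : ℝ≥0∞) * eLpNorm φ p μ := by
    rw [indicatorLp, eLpNorm_congr_ae ((coeFn_compositionOperator_zpow hf hf' j _).trans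
      (hq.ae_eq_comp ((Lp.memLp φ).indicator hA).coeFn_toLp)),
      ← eLpNorm_map_measure (((Lp.aestronglyMeasurable φ).indicator hA).mono_ac
        hq.absolutelyContinuous) (iterEquiv f j).measurable.aemeasurable,
      eLpNorm_indicator_eq_eLpNorm_restrict hA]
    exact eLpNorm_le_of_measure_le hp hM _
  have h2 := ENNReal.toReal_mono
    (ENNReal.mul_ne_top ENNReal.coe_ne_top (Lp.eLpNorm_ne_top φ)) h1
  rwa [ENNReal.toReal_mul, ENNReal.coe_toReal, ← Lp.norm_def, ← Lp.norm_def] at h2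

theorem one_div_toReal_pos (hp : p ≠ ∞) : 0 < (1 / p).toReal := by
  have hp1 : 1 ≤ p := Fact.out
  refine ENNReal.toReal_pos (by simpa using hp) ?_
  simpa using (one_pos.trans_le hp1).ne'

/-- Contraction over the blocks in `S` and expansion over the other blocks give shadowing. -/
theorem hasShadowingProperty_of_decays (hp : p ≠ ∞) (hf : CompositionBound f μ)
    (hf' : CompositionBound f.symm μ) {W : Set X} (hW : IsDissipativeGeneratedBy f μ W)
    (hbd : HasBoundedDistortionOn f μ W) {S : Set ℤ}
    (hl : DecaysLeft (fun k => μ (iterImage f k W)) S)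
    (hr : DecaysRight (fun k => μ (iterImage f k W)) Sᶜ) :
    HasShadowingProperty (compositionOperator 𝕜 p hf hf') := by
  obtain ⟨K, hK0, hK⟩ := hbd
  obtain ⟨C₁, t₁, ht₁, h₁⟩ := hl
  obtain ⟨C₂, t₂, ht₂, h₂⟩ := hr
  set A : Set X := ⋃ k ∈ S, iterImage f k W
  have hA : MeasurableSet A := MeasurableSet.biUnion S.to_countable fun k _ =>
    measurableSet_iterImage f k hW.measurableSet
  have hAc : Aᶜ ⊆ ⋃ k ∈ Sᶜ, iterImage f k W := fun x hx => by
    have hx' : x ∈ ⋃ k : ℤ, iterImage f k W := by rw [hW.iUnion_eq_univ]; trivial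
    obtain ⟨k, hk⟩ := Set.mem_iUnion.1 hx'
    exact Set.mem_biUnion (fun hkS => hx (Set.mem_biUnion hkS hk)) hk
  have hsum : ∀ C t : ℝ≥0, t < 1 →
      Summable fun j : ℕ => ((K ^ 2 * (C * t ^ j)) ^ (1 / p).toReal : ℝ≥0) := fun C t ht => by
    have h : ∀ j : ℕ, (K ^ 2 * (C * t ^ j)) ^ (1 / p).toReal =
        (K ^ 2 * C) ^ (1 / p).toReal * (t ^ (1 / p).toReal) ^ j := fun j => by
      rw [← mul_assoc, NNReal.mul_rpow]
      congr 1
      rw [← NNReal.rpow_natCast, ← NNReal.rpow_natCast, ← NNReal.rpow_mul, ← NNReal.rpow_mul,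
        mul_comm]
    simp only [h]
    exact (NNReal.summable_geometric (NNReal.rpow_lt_one ht (one_div_toReal_pos hp))).mul_left _
  refine hasShadowingProperty_of_summable_splitting _ (indicatorLp hA)
    (NNReal.summable_coe.2 (hsum C₁ t₁ ht₁))
    (NNReal.summable_coe.2 ((NNReal.summable_nat_add_iff 1).2 (hsum C₂ t₂ ht₂)))
    (fun j => NNReal.coe_nonneg _) (fun j => NNReal.coe_nonneg _) (fun j φ => ?_) (fun j φ => ?_)
  · refine norm_compositionOperator_zpow_indicatorLp_le hp hf hf' hA
      (restrict_map_iterEquiv_le hW hK0 hK hA subset_rfl fun k hk => ?_) φ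
    push_cast
    exact h₁ k hk j
  · rw [sub_indicatorLp]
    refine norm_compositionOperator_zpow_indicatorLp_le hp hf hf' hA.compl
      (restrict_map_iterEquiv_le hW hK0 hK hA.compl hAc fun k hk => ?_) φ
    have h := h₂ k hk (j + 1)
    push_cast at h ⊢
    rwa [sub_neg_eq_add]

/-- The average of an `L^p` function over a set of finite measure, as a linear functional. -/
noncomputable def averageLp {W : Set X} (hW : μ W ≠ ∞) : Lp 𝕜 p μ →ₗ[𝕜] 𝕜 where
  toFun φ := (((μ W).toReal⁻¹ : ℝ) : 𝕜) * ∫ x in W, φ x ∂μ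
  map_add' φ ψ := by
    have hint : ∀ χ : Lp 𝕜 p μ, IntegrableOn χ W μ := fun χ =>
      haveI : Fact (μ W < ∞) := ⟨hW.lt_top⟩
      ((Lp.memLp χ).restrict W).integrable Fact.out
    rw [← mul_add, ← integral_add (hint φ) (hint ψ)]
    congr 1
    exact integral_congr_ae (ae_restrict_of_ae (Lp.coeFn_add φ ψ))
  map_smul' a φ := by
    rw [RingHom.id_apply, smul_eq_mul, mul_left_comm, ← integral_const_mul a]
    congr 1
    exact integral_congr_ae (ae_restrict_of_ae (Lp.coeFn_smul a φ))

theorem averageLp_indicatorConstLp {W : Set X} (hWm : MeasurableSet W) (hW0 : μ W ≠ 0)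
    (hW : μ W ≠ ∞) : averageLp hW (indicatorConstLp p hWm hW (1 : 𝕜)) = 1 := by
  have h : ∫ x in W, (indicatorConstLp p hWm hW (1 : 𝕜)) x ∂μ = (((μ W).toReal : ℝ) : 𝕜) := by
    rw [integral_congr_ae (ae_restrict_of_ae indicatorConstLp_coeFn),
      setIntegral_indicator hWm, Set.inter_self]
    simp [Measure.real, Algebra.smul_def]
  change (((μ W).toReal⁻¹ : ℝ) : 𝕜) * _ = 1
  rw [h, ← RCLike.ofReal_mul, inv_mul_cancel₀ (ENNReal.toReal_pos hW0 hW).ne', RCLike.ofReal_one]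

theorem norm_averageLp_le {W : Set X} (hW : μ W ≠ ∞) (φ : Lp 𝕜 p μ) :
    ‖averageLp hW φ‖ ≤ (μ W).toReal⁻¹ * (μ W ^ (1 - 1 / p.toReal)).toReal *
      (eLpNorm φ p (μ.restrict W)).toReal := by
  have hp1 : 1 ≤ p := Fact.out
  have h1 : ‖∫ x in W, φ x ∂μ‖ ≤ (eLpNorm φ 1 (μ.restrict W)).toReal := by
    rw [eLpNorm_one_eq_lintegral_enorm]
    exact (norm_integral_le_lintegral_norm _).trans_eq (by simp only [ofReal_norm])
  have hne : eLpNorm φ p (μ.restrict W) * μ W ^ (1 - 1 / p.toReal) ≠ ∞ := by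
    refine ENNReal.mul_ne_top ((Lp.memLp φ).restrict W).eLpNorm_ne_top
      (ENNReal.rpow_ne_top_of_nonneg ?_ hW)
    rcases eq_or_ne p ∞ with rfl | hp
    · simp
    · have h : 1 ≤ p.toReal := by
        have := ENNReal.toReal_mono hp hp1
        rwa [ENNReal.toReal_one] at this
      exact sub_nonneg.2 ((div_le_one (by positivity)).2 h)
  have h2 := eLpNorm_le_eLpNorm_mul_rpow_measure_univ (μ := μ.restrict W) hp1
    (Lp.aestronglyMeasurable φ).restrict
  rw [Measure.restrict_apply_univ, ENNReal.toReal_one, div_one] at h2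
  have h3 := ENNReal.toReal_mono hne h2
  rw [ENNReal.toReal_mul] at h3
  change ‖(((μ W).toReal⁻¹ : ℝ) : 𝕜) * _‖ ≤ _
  rw [norm_mul, RCLike.norm_ofReal, abs_of_nonneg (by positivity), mul_assoc]
  gcongr
  linarith

/-- On `f^{-n}(W)` the operator `T_f^{-n}` distorts norms by `(μ W / μ(f^{-n} W))^{1/p}`, so the
average over `W` of `T_f^{-n} φ` is at most of order `μ(f^{-n} W)^{-1/p} ‖φ‖`. -/
theorem exists_norm_averageLp_zpow_le (hp : p ≠ ∞) (hf : CompositionBound f μ)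
    (hf' : CompositionBound f.symm μ) {W : Set X} (hW : IsDissipativeGeneratedBy f μ W)
    (hbd : HasBoundedDistortionOn f μ W) :
    ∃ D : ℝ, ∀ (n : ℤ) (φ : Lp 𝕜 p μ),
      ‖averageLp hW.measure_lt_top.ne (((compositionOperator 𝕜 p hf hf') ^ (-n)) φ)‖ ≤
        D * (μ (iterImage f (-n) W)).toReal ^ (-(1 / p.toReal)) * ‖φ‖ := by
  obtain ⟨K, hK0, hK⟩ := hbd
  obtain ⟨c, hc⟩ := exists_hasBoundedRatio hf hf' hW
  refine ⟨(μ W).toReal⁻¹ * (μ W ^ (1 - 1 / p.toReal)).toReal *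
    (K ^ 2 * (μ W).toReal) ^ (1 / p.toReal), fun n φ => ?_⟩
  -- `T_f^{-n}` moves the block of index `-n` to `W`, the block of index `0`.
  set M : ℝ≥0 := (μ W).toNNReal / (μ (iterImage f (-n) W)).toNNReal with hM
  have hq := iterEquiv_quasiMeasurePreserving hf hf' (-n)
  have hWn := measurableSet_iterImage f (-n) hW.measurableSet
  have hle : (μ.map (iterEquiv f (-n))).restrict (iterImage f (-n) W) ≤
      ((K ^ 2 * M : ℝ≥0) : ℝ≥0∞) • μ := by
    refine restrict_map_iterEquiv_le hW hK0 hK (S := {-n}) hWn (by simp) fun k hk => ?_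
    rw [Set.mem_singleton_iff.1 hk, sub_self, iterImage_zero, hM, ENNReal.coe_div,
      ENNReal.coe_toNNReal hW.measure_lt_top.ne, ENNReal.coe_toNNReal (hc.ne_top (-n)),
      ENNReal.div_mul_cancel (hc.ne_zero (-n)) (hc.ne_top (-n))]
    exact (ENNReal.toNNReal_ne_zero.2 ⟨hc.ne_zero (-n), hc.ne_top (-n)⟩)
  have h1 : eLpNorm (((compositionOperator 𝕜 p hf hf') ^ (-n)) φ) p (μ.restrict W) ≤
      (((K ^ 2 * M) ^ (1 / p).toReal : ℝ≥0) : ℝ≥0∞) * eLpNorm φ p μ := by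
    rw [eLpNorm_congr_ae (ae_restrict_of_ae (coeFn_compositionOperator_zpow hf hf' (-n) φ))]
    rw [Measure.restrict_map (iterEquiv f (-n)).measurable hWn, preimage_iterImage, sub_self,
      iterImage_zero] at hle
    rw [← eLpNorm_map_measure ((Lp.aestronglyMeasurable φ).mono_ac
      ((Measure.absolutelyContinuous_of_le hle).trans Measure.smul_absolutelyContinuous))
      (iterEquiv f (-n)).measurable.aemeasurable]
    exact eLpNorm_le_of_measure_le hp hle _
  have h2 := ENNReal.toReal_mono
    (ENNReal.mul_ne_top ENNReal.coe_ne_top (Lp.eLpNorm_ne_top φ)) h1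
  rw [ENNReal.toReal_mul, ENNReal.coe_toReal, ← Lp.norm_def, NNReal.coe_rpow] at h2
  have h3 : ((K ^ 2 * M : ℝ≥0) : ℝ) ^ (1 / p).toReal = (K ^ 2 * (μ W).toReal) ^ (1 / p.toReal) *
      (μ (iterImage f (-n) W)).toReal ^ (-(1 / p.toReal)) := by
    rw [hM, ENNReal.toReal_div, ENNReal.toReal_one, Real.rpow_neg ENNReal.toReal_nonneg,
      ← Real.inv_rpow ENNReal.toReal_nonneg, ← Real.mul_rpow (by positivity) (by positivity)]
    push_cast
    rw [div_eq_mul_inv, mul_assoc]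
  rw [h3] at h2
  refine (norm_averageLp_le hW.measure_lt_top.ne _).trans ?_
  rw [mul_assoc _ (_ ^ _) (_ ^ _), mul_assoc _ (_ * _) ‖φ‖]
  gcongr

theorem norm_compositionOperator_zpow_indicatorConstLp (hp : p ≠ ∞) (hf : CompositionBound f μ)
    (hf' : CompositionBound f.symm μ) {W : Set X} (hWm : MeasurableSet W) (hW : μ W ≠ ∞) (n : ℤ) :
    ‖((compositionOperator 𝕜 p hf hf') ^ n) (indicatorConstLp p hWm hW (1 : 𝕜))‖ =
      (μ (iterImage f (-n) W)).toReal ^ (1 / p.toReal) := by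
  have hp1 : 1 ≤ p := Fact.out
  have hq := iterEquiv_quasiMeasurePreserving hf hf' n
  have h : W.indicator (fun _ => (1 : 𝕜)) ∘ iterEquiv f n =
      (iterImage f (-n) W).indicator fun _ => (1 : 𝕜) := by
    rw [iterImage_eq_preimage, neg_neg]
    rfl
  rw [Lp.norm_def, eLpNorm_congr_ae ((coeFn_compositionOperator_zpow hf hf' n _).trans
    (hq.ae_eq_comp indicatorConstLp_coeFn)), h,
    eLpNorm_indicator_const (measurableSet_iterImage f _ hWm) (one_pos.trans_le hp1).ne' hp,
    ENNReal.toReal_mul, ENNReal.toReal_rpow]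
  simp

/-- The orbit of `1_W` and the average over `W` are a test pair for
`HasShadowingProperty.exists_sum_le`. -/
theorem decays_of_hasShadowingProperty (hp : p ≠ ∞) (hf : CompositionBound f μ)
    (hf' : CompositionBound f.symm μ) {W : Set X} (hW : IsDissipativeGeneratedBy f μ W)
    (hbd : HasBoundedDistortionOn f μ W)
    (hT : HasShadowingProperty (compositionOperator 𝕜 p hf hf')) :
    DecaysLeft (fun k => μ (iterImage f k W)) Set.univ ∨
      DecaysRight (fun k => μ (iterImage f k W)) Set.univ ∨
      (DecaysLeft (fun k => μ (iterImage f k W)) (Set.Iic 0) ∧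
        DecaysRight (fun k => μ (iterImage f k W)) (Set.Ici 0)) := by
  have hp1 : 1 ≤ p := Fact.out
  obtain ⟨c, hc⟩ := exists_hasBoundedRatio hf hf' hW
  obtain ⟨D, hD⟩ := exists_norm_averageLp_zpow_le (𝕜 := 𝕜) hp hf hf' hW hbd
  have hpos : ∀ n : ℤ, 0 < (μ (iterImage f (-n) W)).toReal := fun n =>
    ENNReal.toReal_pos (hc.ne_zero _) (hc.ne_top _)
  obtain ⟨C, hC, u, hu, hub⟩ := hT.exists_sum_le
    (indicatorConstLp p hW.measurableSet hW.measure_lt_top.ne 1)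
    (averageLp hW.measure_lt_top.ne)
    (averageLp_indicatorConstLp hW.measurableSet hW.measure_pos.ne' hW.measure_lt_top.ne)
    (b := fun n => (μ (iterImage f (-n) W)).toReal ^ (-(1 / p.toReal)))
    (fun n => Real.rpow_pos_of_pos (hpos n) _)
    (fun n => by
      rw [norm_compositionOperator_zpow_indicatorConstLp hp, ← Real.rpow_add (hpos n),
        neg_add_cancel, Real.rpow_zero]) hD
  exact hc.decays_of_abs_sum_le
    (ENNReal.toReal_pos (one_pos.trans_le hp1).ne' hp) hC hu hub

end Operator

end CompositionDynamics

theorem mainTheorem2 {X : Type*} [MeasurableSpace X] (μ : Measure X) [SigmaFinite μ]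
    (𝕜 : Type*) [RCLike 𝕜] (p : ℝ≥0∞) [Fact (1 ≤ p)] (hp : p ≠ ∞)
    (f : X ≃ᵐ X)
    (hf : CompositionDynamics.CompositionBound f μ)
    (hf' : CompositionDynamics.CompositionBound f.symm μ)
    (W : Set X)
    (hW : CompositionDynamics.IsDissipativeGeneratedBy f μ W)
    (hbd : CompositionDynamics.HasBoundedDistortionOn f μ W) :
    CompositionDynamics.HasShadowingProperty
        (CompositionDynamics.compositionOperator 𝕜 p hf hf') ↔
      (CompositionDynamics.ConditionHC f μ W ∨
        CompositionDynamics.ConditionHD f μ W ∨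
        CompositionDynamics.ConditionGH f μ W) := by
  obtain ⟨c, hc⟩ := CompositionDynamics.exists_hasBoundedRatio hf hf' hW
  rw [CompositionDynamics.conditionHC_iff hc, CompositionDynamics.conditionHD_iff hc,
    CompositionDynamics.conditionGH_iff hc]
  refine ⟨CompositionDynamics.decays_of_hasShadowingProperty hp hf hf' hW hbd, ?_⟩
  have hempty : ∀ k : ℤ, k ∉ (Set.univ : Set ℤ)ᶜ := by simp
  rintro (h | h | ⟨hl, C, t, ht, hr⟩)
  · exact CompositionDynamics.hasShadowingProperty_of_decays hp hf hf' hW hbd h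
      ⟨0, 0, one_pos, fun k hk => (hempty k hk).elim⟩
  · refine CompositionDynamics.hasShadowingProperty_of_decays (S := ∅) hp hf hf' hW hbd
      ⟨0, 0, one_pos, fun k hk => hk.elim⟩ ?_
    rwa [Set.compl_empty]
  · refine CompositionDynamics.hasShadowingProperty_of_decays hp hf hf' hW hbd hl
      ⟨C, t, ht, fun k hk => hr k ?_⟩
    simp only [Set.mem_compl_iff, Set.mem_Iic, not_le] at hk
    exact hk.le
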